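/- **Theorem 5.3 (path differentiability of min-max solutions).** Let $\Theta\subset\mathbb R^p$ be nonempty, open and connected, let $X\subset\mathbb R^n$ be nonempty, closed and convex, let $Y\subset\mathbb R^m$ be nonempty, compact and convex, and let $\alpha>0$. For each $\theta\in\Theta$ let $\Phi_\theta:\mathbb R^n\times\mathbb R^m\to\mathbb R$ be continuous, with $\Phi_\theta(\cdot,y)$ $\alpha$-strongly convex for every $y\in\mathbb R^m$ and $\Phi_\theta(x,\cdot)$ $\alpha$-strongly concave for every $x\in\mathbb R^n$; assume also that for every $(x,y)\in\mathbb R^n\times\mathbb R^m$ the map $\theta\mapsto\Phi_\theta(x,y)$ is Lipschitz continuous on $\Theta$. Consider the problem $\min_{x\in X}\max_{y\in Y}\Phi_\theta(x,y)$ and the set-valued operator on $\mathbb R^n\times\mathbb R^m$ $$\mathcal A_\theta(x,y)=\bigl(\partial_x\Phi_\theta(x,y)+N_X(x)\bigr)\times\bigl(-\partial_y\Phi_\theta(x,y)+N_Y(y)\bigr),$$ where $\partial_x\Phi_\theta(x,y)$ is the convex subdifferential of $\Phi_\theta(\cdot,y)$ at $x$, $-\partial_y\Phi_\theta(x,y)$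 is the convex subdifferential of $-\Phi_\theta(x,\cdot)$ at $y$, and $N_X,N_Y$ are the normal cones (empty outside the set). Let $\gamma\in(0,1/\alpha)$ and let $T(\theta,z)=(\mathrm{Id}+\gamma\mathcal A_\theta)^{-1}(z)$ be the resolvent of $\gamma\mathcal A_\theta$. A *conservative Jacobian* on an open set $U$ of a locally Lipschitz function $f:U\to\mathbb R^k$ is a set-valued map $\mathcal J$ from $U$ to $k\times d$ matrices ($U\subset\mathbb R^d$) with nonempty values, locally bounded, with graph closed relative to $U$, such that for every absolutely continuous curve $c:[0,1]\to U$, for almost every $t\in[0,1]$, $\frac{d}{dt}f(c(t))=J\,\dot c(t)$ for all $J\in\mathcal J(c(t))$. The function $f$ is *path differentiable* on $U$ if it is locally Lipschitz on $U$ and admits a conservative Jacobian there. The *Clarke Jacobian* $\mathrm{Jac}^c_f(x)$ is the convex hull of all limits of classical Jacobians $\mathrm{Jac}_f(x_k)$ along sequences $x_k\to x$ of points of differentiability of $f$. Assume that $T$ is path differentiable on $\Theta\times\mathbb R^{n+m}$, jointly in $(\theta,z)$. Then for each $\theta\in\Theta$ there is exactly one saddle point $z^\star(\theta)=(x^\star(\theta),y^\star(\theta))$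 of $\Phi_\theta$ over $X\times Y$; the map $z^\star$ is path differentiable on $\Theta$; for all $\theta\in\Theta$ and all $[U\ V_1\ V_2]\in\mathrm{Jac}^c_T(\theta,z^\star(\theta))$ the matrix $\mathrm{Id}_{n+m}-[V_1\ V_2]$ is invertible; and $$\theta\mapsto\bigl\{(\mathrm{Id}_{n+m}-[V_1\ V_2])^{-1}U:\ [U\ V_1\ V_2]\in\mathrm{Jac}^c_T(\theta,z^\star(\theta))\bigr\}$$ is a conservative Jacobian of $z^\star$ on $\Theta$. -/

import Mathlib

open Set Filter Topology MeasureTheory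

/-- `J` is a conservative Jacobian on the set `U` for `f : E → F` (a matrix being identified with
the linear map it represents): on `U` it has nonempty values, is locally bounded, its graph is
closed relative to `U`, and along every absolutely continuous curve `c : [0,1] → U`, for almost
every `t ∈ [0,1]`, `(f ∘ c)'(t) = u (c'(t))` for all `u ∈ J (c t)`. (In finite dimension an
absolutely continuous curve is differentiable almost everywhere, so `deriv c t` is `c'(t)`
for almost every `t`.) -/
structure IsConservativeJacobianOn {E F : Type*} [NormedAddCommGroup E] [NormedSpace ℝ E]
    [NormedAddCommGroup F] [NormedSpace ℝ F]
    (U : Set E) (f : E → F) (J : E → Set (E →L[ℝ] F)) : Prop where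
  nonempty : ∀ x ∈ U, (J x).Nonempty
  locallyBounded : ∀ x ∈ U, ∃ C : ℝ, ∀ᶠ y in 𝓝[U] x, ∀ u ∈ J y, ‖u‖ ≤ C
  closedGraph : ∀ x ∈ U, ∀ u : E →L[ℝ] F,
    (x, u) ∈ closure {q : E × (E →L[ℝ] F) | q.1 ∈ U ∧ q.2 ∈ J q.1} → u ∈ J x
  chainRule : ∀ c : ℝ → E, AbsolutelyContinuousOnInterval c 0 1 → (∀ t ∈ Icc (0 : ℝ) 1, c t ∈ U) →
    ∀ᵐ t ∂(volume.restrict (Icc (0 : ℝ) 1)),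
      ∀ u ∈ J (c t), HasDerivAt (fun s => f (c s)) (u (deriv c t)) t

/-- `f` is path differentiable on `U`: it is locally Lipschitz there and admits a conservative
Jacobian. -/
def PathDifferentiableOn {E F : Type*} [NormedAddCommGroup E] [NormedSpace ℝ E]
    [NormedAddCommGroup F] [NormedSpace ℝ F] (U : Set E) (f : E → F) : Prop :=
  LocallyLipschitzOn U f ∧ ∃ J : E → Set (E →L[ℝ] F), IsConservativeJacobianOn U f J

/-- The Clarke Jacobian of `f` at `x`: the convex hull of all limits of derivatives of `f` along
sequences of differentiability points converging to `x`. -/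
def clarkeJacobian {E F : Type*} [NormedAddCommGroup E] [NormedSpace ℝ E]
    [NormedAddCommGroup F] [NormedSpace ℝ F] (f : E → F) (x : E) : Set (E →L[ℝ] F) :=
  convexHull ℝ {M | ∃ s : ℕ → E, (∀ k, DifferentiableAt ℝ f (s k)) ∧
    Tendsto s atTop (𝓝 x) ∧ Tendsto (fun k => fderiv ℝ f (s k)) atTop (𝓝 M)}

/-- The subdifferential of a real-valued function. -/
def subdifferential {E : Type*} [NormedAddCommGroup E] [InnerProductSpace ℝ E]
    (f : E → ℝ) (x : E) : Set E :=
  {u | ∀ y, f x + inner ℝ u (y - x) ≤ f y}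

/-- The normal cone to `C` at `x`; it is empty when `x ∉ C`. -/
def normalCone {E : Type*} [NormedAddCommGroup E] [InnerProductSpace ℝ E]
    (C : Set E) (x : E) : Set E :=
  {v | x ∈ C ∧ ∀ y ∈ C, inner ℝ v (y - x) ≤ 0}

/-- The operator `(x, y) ↦ (∂ₓφ(x,y) + N_X(x)) × (-∂_yφ(x,y) + N_Y(y))` of the min-max problem
`min_{x ∈ X} max_{y ∈ Y} φ(x,y)`, where `-∂_yφ(x,y)` is the subdifferential at `y` of the convex
function `-φ(x,·)`. -/
def minMaxOperator {E F : Type*} [NormedAddCommGroup E] [InnerProductSpace ℝ E]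
    [NormedAddCommGroup F] [InnerProductSpace ℝ F]
    (X : Set E) (Y : Set F) (φ : E → F → ℝ) (z : E × F) : Set (E × F) :=
  {w | (∃ u ∈ subdifferential (fun x => φ x z.2) z.1, ∃ v ∈ normalCone X z.1, w.1 = u + v) ∧
    (∃ u ∈ subdifferential (fun y => -φ z.1 y) z.2, ∃ v ∈ normalCone Y z.2, w.2 = u + v)}

open Classical in
/-- The resolvent `(Id + γA)⁻¹` of the set-valued operator `γA`: the point `w` with `z ∈ w + γ A w`
(there is exactly one when `γ > 0` and `A` is maximal monotone). -/
noncomputable def resolventMap {E : Type*} [AddCommGroup E] [Module ℝ E]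
    (γ : ℝ) (A : E → Set E) (z : E) : E :=
  if h : ∃ w, ∃ a ∈ A w, z = w + γ • a then h.choose else 0

/-- `z = (x, y)` is a saddle point of `φ` over `X × Y`. -/
def IsSaddle {E F : Type*} (X : Set E) (Y : Set F) (φ : E → F → ℝ) (z : E × F) : Prop :=
  z.1 ∈ X ∧ z.2 ∈ Y ∧ IsSaddlePointOn X Y φ z.1 z.2

/-! ### Subgradients, optimality conditions and existence of saddle points. -/

section ConvexAnalysis

variable {E F : Type*} [NormedAddCommGroup E] [InnerProductSpace ℝ E]
  [NormedAddCommGroup F] [InnerProductSpace ℝ F]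

/-! The operator `minMaxOperator X Y φ` is strongly monotone with constant `α`
(`minMaxOperator_strongMono`), and `Id + γA` is onto because the resolvent equation at `a` is the
optimality condition of a saddle point of `φ` regularized around `a` (`exists_isSaddle`, built on
Sion's theorem). Hence the resolvent `T(θ, ·)` is a contraction of ratio `κ = (1 + γα)⁻¹` in the
Euclidean norm. The saddle point is unique, is a zero of the operator, and is therefore the fixed
point of `T(θ, ·)`.

What remains is implicit differentiation of the fixed point of a path differentiable contraction.
Difference quotients, their limits and convex combinations inherit the ratio, so the `z`-block `V`
of every Clarke element satisfies `‖Vh‖ ≤ κ‖h‖` and `1 - V` is invertible. The fixed point is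
locally Lipschitz, so it maps absolutely continuous curves to such curves. Differentiating `T(c,
z(c)) = z(c)` along the curve gives `ż = Uċ + Vż`, that is `ż = (1 - V)⁻¹Uċ`.

The chain rule is needed for the Clarke Jacobian, while only some conservative Jacobian `J` is
given. Almost everywhere along a curve all elements of `J` agree on the velocity, and upper
semicontinuity of `J` forces the Clarke elements to agree with them there
(`IsConservativeJacobianOn.clarkeJacobian_apply_eq`). -/

lemma nonneg_of_forall_add_mul_nonneg {a b : ℝ} (h : ∀ t ∈ Ioo (0 : ℝ) 1, 0 ≤ a + t * b) :
    0 ≤ a := by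
  have hlim : Tendsto (fun t : ℝ => a + t * b) (𝓝[>] 0) (𝓝 a) := by
    have : Continuous fun t : ℝ => a + t * b := by fun_prop
    simpa using (this.tendsto 0).mono_left nhdsWithin_le_nhds
  exact ge_of_tendsto hlim (by
    filter_upwards [Ioo_mem_nhdsGT (zero_lt_one' ℝ)] with t ht using h t ht)

/-- A subgradient of a strongly convex function gives a quadratic lower bound. -/
lemma StrongConvexOn.le_of_mem_subdifferential {α : ℝ} {f : E → ℝ}
    (hf : StrongConvexOn univ α f) {x u : E} (hu : u ∈ subdifferential f x) (y : E) :
    f x + inner ℝ u (y - x) + α / 2 * ‖y - x‖ ^ 2 ≤ f y := by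
  have key : 0 ≤ f y - f x - inner ℝ u (y - x) - α / 2 * ‖y - x‖ ^ 2 := by
    -- Strong convexity and the subgradient inequality are compared at `(1 - t)x + ty`, divided by
    -- `t`, and `t` tends to `0`.
    refine nonneg_of_forall_add_mul_nonneg (b := α / 2 * ‖y - x‖ ^ 2) fun t ht => ?_
    have h1 := hf.2 (mem_univ x) (mem_univ y) (sub_nonneg.2 ht.2.le) ht.1.le (by ring)
    have h2 := hu ((1 - t) • x + t • y)
    have h3 : (1 - t) • x + t • y - x = t • (y - x) := by module
    rw [h3, inner_smul_right] at h2
    rw [norm_sub_rev x y] at h1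
    simp only [smul_eq_mul] at h1
    have h4 : 0 ≤ t * (f y - f x - inner ℝ u (y - x) - α / 2 * ‖y - x‖ ^ 2
        + t * (α / 2 * ‖y - x‖ ^ 2)) := by nlinarith
    exact nonneg_of_mul_nonneg_right h4 ht.1
  linarith

/-- First-order optimality condition for minimizing a continuous convex function over a convex
set. -/
lemma exists_mem_subdifferential_neg_mem_normalCone [CompleteSpace E] {f : E → ℝ}
    (hf : ConvexOn ℝ univ f) (hc : Continuous f) {X : Set E} (hX : Convex ℝ X) {x : E}
    (hx : x ∈ X) (hmin : ∀ y ∈ X, f x ≤ f y) :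
    ∃ u ∈ subdifferential f x, -u ∈ normalCone X x := by
  -- Minimality makes the open strict epigraph of `f` disjoint from `X × (-∞, f x]`; a separating
  -- functional has vertical component `b`, and dividing its horizontal part by `-b` yields the
  -- subgradient.
  have hS : Convex ℝ {q : E × ℝ | q.1 ∈ univ ∧ f q.1 < q.2} := hf.convex_strict_epigraph
  have hSo : IsOpen {q : E × ℝ | q.1 ∈ univ ∧ f q.1 < q.2} := by
    simp only [mem_univ, true_and]
    exact isOpen_lt (by fun_prop) (by fun_prop)
  have hdisj : Disjoint {q : E × ℝ | q.1 ∈ univ ∧ f q.1 < q.2} (X ×ˢ Iic (f x)) := by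
    rw [Set.disjoint_left]
    rintro ⟨y, r⟩ ⟨-, h1⟩ ⟨h2, h3⟩
    have := hmin y h2
    simp only [mem_Iic] at h1 h3
    linarith
  obtain ⟨G, s, hGS, hGT⟩ := geometric_hahn_banach_open hS hSo (hX.prod (convex_Iic _)) hdisj
  set g : StrongDual ℝ E := G ∘L ContinuousLinearMap.inl ℝ E ℝ with hg
  set b : ℝ := G (0, 1) with hb
  have hG : ∀ y r, G (y, r) = g y + r * b := by
    intro y r
    have : ((y, r) : E × ℝ) = (y, 0) + r • (0, 1) := by simp
    rw [this, map_add, map_smul]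
    simp [hg, hb]
  have hT : ∀ y ∈ X, s ≤ g y + f x * b := fun y hy => by
    simpa [hG] using hGT (y, f x) ⟨hy, le_refl (f x)⟩
  have hS' : ∀ y r, f y < r → g y + r * b < s := fun y r hr => by
    simpa [hG] using hGS (y, r) ⟨mem_univ _, hr⟩
  -- The hyperplane is not vertical: it separates `(x, f x + 1)` from `(x, f x)`.
  have hb0 : b < 0 := by
    have h1 := hS' x (f x + 1) (by linarith)
    have h2 := hT x hx
    linarith
  have hle : ∀ y, g y + f y * b ≤ s := by
    intro y
    have : 0 ≤ s - (g y + f y * b) := by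
      refine nonneg_of_forall_add_mul_nonneg (b := -b) fun t ht => ?_
      have := hS' y (f y + t) (by linarith [ht.1])
      linarith
    linarith
  set u : E := (-b)⁻¹ • (InnerProductSpace.toDual ℝ E).symm g with hu
  have hin : ∀ y, inner ℝ u y = (-b)⁻¹ * g y := fun y => by
    rw [hu, real_inner_smul_left, InnerProductSpace.toDual_symm_apply]
  have hbi : 0 < (-b)⁻¹ := inv_pos.2 (by linarith)
  refine ⟨u, fun y => ?_, hx, fun y hy => ?_⟩
  · rw [hin, map_sub]
    have h1 := hle y
    have h2 := hT x hx
    have h3 : (-b)⁻¹ * (g y - g x) ≤ (-b)⁻¹ * ((-b) * (f y - f x)) :=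
      mul_le_mul_of_nonneg_left (by linarith) hbi.le
    rw [inv_mul_cancel_left₀ (by linarith)] at h3
    linarith
  · rw [inner_neg_left, hin, map_sub]
    have h1 := hT y hy
    have h2 := hle x
    have : 0 ≤ (-b)⁻¹ * (g y - g x) := mul_nonneg hbi.le (by linarith)
    linarith

lemma subdifferential_nonempty [CompleteSpace E] {f : E → ℝ} (hf : ConvexOn ℝ univ f)
    (hc : Continuous f) (x : E) : (subdifferential f x).Nonempty := by
  obtain ⟨u, hu, -⟩ := exists_mem_subdifferential_neg_mem_normalCone hf hc
    (convex_singleton x) (mem_singleton x) (by simp)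
  exact ⟨u, hu⟩

/-- First-order optimality condition for minimizing `f + c / 2 * ‖· - a‖ ^ 2` over a convex set. -/
lemma exists_add_eq_of_isMin_add_sq [CompleteSpace E] {f : E → ℝ} (hf : ConvexOn ℝ univ f)
    (hc : Continuous f) {X : Set E} (hX : Convex ℝ X) {x a : E} {c : ℝ} (hx : x ∈ X)
    (hmin : ∀ y ∈ X, f x + c / 2 * ‖x - a‖ ^ 2 ≤ f y + c / 2 * ‖y - a‖ ^ 2) :
    ∃ u ∈ subdifferential f x, ∃ v ∈ normalCone X x, c • (a - x) = u + v := by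
  -- The quadratic is replaced by its linearization at `x`, which `x` still minimizes to first
  -- order; no sign of `c` is needed.
  have hlin : ConvexOn ℝ univ fun y => f y + inner ℝ (c • (x - a)) (y - x) := by
    refine hf.add ⟨convex_univ, fun y _ z _ s t _ _ hst => le_of_eq ?_⟩
    simp only [inner_sub_right, inner_add_right, inner_smul_right, smul_eq_mul]
    obtain rfl : s = 1 - t := by linarith
    ring
  obtain ⟨u, hu, hv⟩ := exists_mem_subdifferential_neg_mem_normalCone hlin
    (by fun_prop) hX hx (fun y hy => by
    have key : 0 ≤ f y - f x + inner ℝ (c • (x - a)) (y - x) := by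
      refine nonneg_of_forall_add_mul_nonneg (b := c / 2 * ‖y - x‖ ^ 2) fun t ht => ?_
      have h1 := hf.2 (mem_univ x) (mem_univ y) (sub_nonneg.2 ht.2.le) ht.1.le (by ring)
      have h2 := hmin _ (hX hx hy (sub_nonneg.2 ht.2.le) ht.1.le (by ring))
      have h3 : (1 - t) • x + t • y - a = (x - a) + t • (y - x) := by module
      rw [h3, norm_add_sq_real, inner_smul_right, norm_smul, mul_pow, Real.norm_eq_abs,
        sq_abs] at h2
      simp only [smul_eq_mul] at h1
      rw [real_inner_smul_left]
      refine nonneg_of_mul_nonneg_right ?_ ht.1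
      nlinarith
    simpa using by linarith)
  refine ⟨u - c • (x - a), fun y => ?_, -u, hv, by module⟩
  have := hu y
  simp only [sub_self, inner_zero_right, add_zero] at this
  rw [inner_sub_left]
  linarith

/-- Coercivity: the quadratic lower bound from a subgradient at `0` dominates its linear term. It
compensates for the possible unboundedness of `X` in the existence of saddle points. -/
lemma StrongConvexOn.exists_norm_le_of_le [CompleteSpace E] {f : E → ℝ} {α : ℝ} (hα : 0 < α)
    (hf : StrongConvexOn univ α f) (hc : Continuous f) (M : ℝ) :
    ∃ R, ∀ x, f x ≤ M → ‖x‖ ≤ R := by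
  obtain ⟨u, hu⟩ := subdifferential_nonempty (hf.strictConvexOn hα).convexOn hc 0
  refine ⟨2 / α * (‖u‖ + |M - f 0|) + 1, fun x hx => ?_⟩
  by_contra! h
  have h1 := hf.le_of_mem_subdifferential hu x
  have h2 := neg_le_of_abs_le (abs_real_inner_le_norm u x)
  simp only [sub_zero] at h1
  have h3 : 1 ≤ ‖x‖ := by
    have : 0 ≤ 2 / α * (‖u‖ + |M - f 0|) := by positivity
    linarith
  have h4 : ‖u‖ + |M - f 0| < α / 2 * ‖x‖ := by
    have : 2 / α * (‖u‖ + |M - f 0|) < ‖x‖ := by linarith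
    have := mul_lt_mul_of_pos_left this (half_pos hα)
    rwa [← mul_assoc, show α / 2 * (2 / α) = 1 by field_simp, one_mul] at this
  have h5 := mul_lt_mul_of_pos_right h4 (zero_lt_one.trans_le h3)
  have h6 : |M - f 0| ≤ |M - f 0| * ‖x‖ := le_mul_of_one_le_right (abs_nonneg _) h3
  have h7 := le_abs_self (M - f 0)
  nlinarith

/-- A continuous function that is strongly convex in the first and concave in the second variable
has a saddle point over the product of a closed convex set and a compact convex set. -/
lemma exists_isSaddle [FiniteDimensional ℝ E] {X : Set E} (hXne : X.Nonempty)
    (hXcl : IsClosed X) (hXco : Convex ℝ X) {Y : Set F} (hYne : Y.Nonempty) (hYcp : IsCompact Y)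
    (hYco : Convex ℝ Y) {φ : E → F → ℝ} (hφ : Continuous fun z : E × F => φ z.1 z.2)
    {α : ℝ} (hα : 0 < α) (hconv : ∀ y, StrongConvexOn univ α fun x => φ x y)
    (hconc : ∀ x, ConcaveOn ℝ univ fun y => φ x y) :
    ∃ z, IsSaddle X Y φ z := by
  have := FiniteDimensional.complete ℝ E
  have hφ1 : ∀ y, Continuous fun x => φ x y := fun y => hφ.comp (by fun_prop : Continuous
    fun x : E => (x, y))
  have hφ2 : ∀ x, Continuous fun y => φ x y := fun x => hφ.comp (by fun_prop : Continuous
    fun y : F => (x, y))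
  have hconv' : ∀ y, ConvexOn ℝ univ fun x => φ x y :=
    fun y => ((hconv y).strictConvexOn hα).convexOn
  obtain ⟨x₀, hx₀⟩ := hXne
  obtain ⟨y₀, hy₀⟩ := hYne
  obtain ⟨M, hM⟩ := (hYcp.image (hφ2 x₀)).bddAbove
  obtain ⟨R, hR⟩ := (hconv y₀).exists_norm_le_of_le hα (hφ1 y₀) M
  -- The ball contains `x₀`, and the `+ 1` keeps the truncated solution, of norm at most `R`, off
  -- its boundary. It is then a local minimizer on `X`, hence a global one by convexity.
  set r := max (R + 1) ‖x₀‖ with hr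
  have hcx : Convex ℝ (X ∩ Metric.closedBall 0 r) := hXco.inter (convex_closedBall _ _)
  obtain ⟨a, ha, b, hb, hab⟩ := Sion.exists_isSaddlePointOn (X := X ∩ Metric.closedBall 0 r)
    (Y := Y) (f := φ) ⟨x₀, hx₀, by simp [hr]⟩ hcx
    ((isCompact_closedBall _ _).inter_left hXcl)
    (fun y _ => (hφ1 y).lowerSemicontinuous.lowerSemicontinuousOn _)
    (fun y _ => ((hconv' y).subset (subset_univ _) hcx).quasiconvexOn) hYco ⟨y₀, hy₀⟩ hYcp
    (fun x _ => (hφ2 x).upperSemicontinuous.upperSemicontinuousOn _)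
    (fun x _ => ((hconc x).subset (subset_univ _) hYco).quasiconcaveOn)
  have hbound : ‖a‖ ≤ R := by
    refine hR a ((hab x₀ ⟨hx₀, by simp [hr]⟩ y₀ hy₀).trans (hM (mem_image_of_mem _ hb)))
  have hmin : IsMinOn (fun x => φ x b) X a := by
    refine IsMinOn.of_isLocalMinOn_of_convexOn ha.1 ?_ ((hconv' b).subset (subset_univ _) hXco)
    have hnear : ∀ᶠ x in 𝓝[X] a, ‖x‖ < r := by
      refine nhdsWithin_le_nhds (continuous_norm.continuousAt.eventually_lt_const ?_)
      exact (lt_of_le_of_lt hbound (by linarith)).trans_le (le_max_left _ _)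
    filter_upwards [hnear, self_mem_nhdsWithin] with x hx1 hx2
    exact hab x ⟨hx2, by simpa using hx1.le⟩ b hb
  exact ⟨(a, b), ha.1, hb, fun x hx y hy => (hab a ha y hy).trans (hmin hx)⟩

lemma convexOn_mul_norm_sub_sq {c : ℝ} (hc : 0 ≤ c) (a : E) :
    ConvexOn ℝ univ fun x => c / 2 * ‖x - a‖ ^ 2 := by
  have := ((convexOn_univ_dist a).pow (fun _ _ => dist_nonneg) 2).smul (by positivity : 0 ≤ c / 2)
  simpa [dist_eq_norm] using this

end ConvexAnalysis

/-! ### Monotonicity of the min-max operator and contraction of its resolvent. -/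

section MinMaxOperator

variable {E F : Type*} [NormedAddCommGroup E] [InnerProductSpace ℝ E]
  [NormedAddCommGroup F] [InnerProductSpace ℝ F] {X : Set E} {Y : Set F} {φ : E → F → ℝ} {α : ℝ}

/-- The min-max operator of a strongly convex-concave function is strongly monotone. -/
lemma minMaxOperator_strongMono (hconv : ∀ y, StrongConvexOn univ α fun x => φ x y)
    (hconc : ∀ x, StrongConcaveOn univ α fun y => φ x y) {z z' w w' : E × F}
    (hw : w ∈ minMaxOperator X Y φ z) (hw' : w' ∈ minMaxOperator X Y φ z') :
    α * (‖z.1 - z'.1‖ ^ 2 + ‖z.2 - z'.2‖ ^ 2) ≤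
      inner ℝ (w.1 - w'.1) (z.1 - z'.1) + inner ℝ (w.2 - w'.2) (z.2 - z'.2) := by
  obtain ⟨x, y⟩ := z
  obtain ⟨x', y'⟩ := z'
  obtain ⟨w₁, w₂⟩ := w
  obtain ⟨w₁', w₂'⟩ := w'
  obtain ⟨⟨u, hu, v, hv, rfl⟩, p, hp, q, hq, rfl⟩ := hw
  obtain ⟨⟨u', hu', v', hv', rfl⟩, p', hp', q', hq', rfl⟩ := hw'
  dsimp only at *
  have hneg : ∀ x, StrongConvexOn univ α fun y => -φ x y := fun x => (hconc x).neg
  -- In the sum of these four inequalities the values of `φ` at the corners `(x, y)`, `(x', y)`,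
  -- `(x, y')`, `(x', y')` cancel, and each squared distance appears twice with factor `α / 2`.
  have h1 := (hconv y).le_of_mem_subdifferential hu x'
  have h2 := (hconv y').le_of_mem_subdifferential hu' x
  have h3 := (hneg x).le_of_mem_subdifferential hp y'
  have h4 := (hneg x').le_of_mem_subdifferential hp' y
  have h5 := hv.2 x' hv'.1
  have h6 := hv'.2 x hv.1
  have h7 := hq.2 y' hq'.1
  have h8 := hq'.2 y hq.1
  rw [norm_sub_rev x' x] at h1
  rw [norm_sub_rev y' y] at h3
  simp only [inner_sub_left, inner_sub_right, inner_add_left] at *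
  linarith

/-- Saddle points of a regularized convex-concave function solve a resolvent equation. -/
lemma exists_mem_minMaxOperator_eq_smul [CompleteSpace E] [CompleteSpace F]
    (hXco : Convex ℝ X) (hYco : Convex ℝ Y) (hφ : Continuous fun z : E × F => φ z.1 z.2)
    (hconv : ∀ y, ConvexOn ℝ univ fun x => φ x y) (hconc : ∀ x, ConcaveOn ℝ univ fun y => φ x y)
    {c : ℝ} {a z : E × F}
    (hz : IsSaddle X Y (fun x y => φ x y + c / 2 * ‖x - a.1‖ ^ 2 - c / 2 * ‖y - a.2‖ ^ 2) z) :
    c • (a - z) ∈ minMaxOperator X Y φ z := by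
  obtain ⟨hx, hy, hs⟩ := hz
  constructor
  · obtain ⟨u, hu, v, hv, h⟩ := exists_add_eq_of_isMin_add_sq (hconv z.2)
      (hφ.comp (by fun_prop : Continuous fun x : E => (x, z.2))) hXco hx (a := a.1) (c := c)
      fun x hx' => by have := hs x hx' z.2 hy; linarith
    exact ⟨u, hu, v, hv, h⟩
  · obtain ⟨u, hu, v, hv, h⟩ := exists_add_eq_of_isMin_add_sq (hconc z.1).neg
      (hφ.comp (by fun_prop : Continuous fun y : F => (z.1, y))).neg hYco hy (a := a.2) (c := c)
      fun y hy' => by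
        have := hs z.1 hx y hy'
        simp only [Pi.neg_apply]
        linarith
    exact ⟨u, hu, v, hv, h⟩

lemma zero_mem_minMaxOperator_of_isSaddle [CompleteSpace E] [CompleteSpace F]
    (hXco : Convex ℝ X) (hYco : Convex ℝ Y) (hφ : Continuous fun z : E × F => φ z.1 z.2)
    (hconv : ∀ y, ConvexOn ℝ univ fun x => φ x y) (hconc : ∀ x, ConcaveOn ℝ univ fun y => φ x y)
    {z : E × F} (hz : IsSaddle X Y φ z) : 0 ∈ minMaxOperator X Y φ z := by
  simpa using exists_mem_minMaxOperator_eq_smul hXco hYco hφ hconv hconc (c := 0) (a := 0) (z := z)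
    (by simpa using hz)

/-- The operator `Id + γ A` is onto. -/
lemma exists_eq_add_smul_minMaxOperator [FiniteDimensional ℝ E] [FiniteDimensional ℝ F]
    (hXne : X.Nonempty) (hXcl : IsClosed X) (hXco : Convex ℝ X) (hYne : Y.Nonempty)
    (hYcp : IsCompact Y) (hYco : Convex ℝ Y) (hφ : Continuous fun z : E × F => φ z.1 z.2)
    (hα : 0 < α) (hconv : ∀ y, StrongConvexOn univ α fun x => φ x y)
    (hconc : ∀ x, ConcaveOn ℝ univ fun y => φ x y) {γ : ℝ} (hγ : 0 < γ) (a : E × F) :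
    ∃ z, ∃ w ∈ minMaxOperator X Y φ z, a = z + γ • w := by
  have := FiniteDimensional.complete ℝ E
  have := FiniteDimensional.complete ℝ F
  have hγ' : 0 ≤ γ⁻¹ := (inv_pos.2 hγ).le
  -- With weight `γ⁻¹` the optimality condition puts `γ⁻¹(a - z)` in the operator at `z`, which is
  -- the resolvent equation.
  obtain ⟨z, hz⟩ := exists_isSaddle hXne hXcl hXco hYne hYcp hYco
    (φ := fun x y => φ x y + γ⁻¹ / 2 * ‖x - a.1‖ ^ 2 - γ⁻¹ / 2 * ‖y - a.2‖ ^ 2)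
    (by fun_prop) hα (fun y => by
      have h := (UniformConvexOn.add (hconv y)
        (convexOn_mul_norm_sub_sq hγ' a.1).uniformConvexOn_zero).add
        (convexOn_const (-(γ⁻¹ / 2 * ‖y - a.2‖ ^ 2)) convex_univ).uniformConvexOn_zero
      simpa [StrongConvexOn, sub_eq_add_neg, Pi.add_def] using h)
    (fun x => by
      have h := ((hconc x).add (concaveOn_const (γ⁻¹ / 2 * ‖x - a.1‖ ^ 2) convex_univ)).sub
        (convexOn_mul_norm_sub_sq hγ' a.2)
      exact h)
  refine ⟨z, _, exists_mem_minMaxOperator_eq_smul hXco hYco hφ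
    (fun y => ((hconv y).strictConvexOn hα).convexOn) hconc hz, ?_⟩
  rw [smul_inv_smul₀ hγ.ne']
  abel

lemma resolventMap_spec {V : Type*} [AddCommGroup V] [Module ℝ V] {A : V → Set V} {γ : ℝ} {z : V}
    (h : ∃ w, ∃ a ∈ A w, z = w + γ • a) :
    ∃ a ∈ A (resolventMap γ A z), z = resolventMap γ A z + γ • a := by
  rw [resolventMap, dif_pos h]
  exact h.choose_spec

/-- Surjectivity of `Id + γA` rules out the default value `0` of `resolventMap`. -/
lemma resolventMap_minMaxOperator_spec [FiniteDimensional ℝ E] [FiniteDimensional ℝ F]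
    (hXne : X.Nonempty) (hXcl : IsClosed X) (hXco : Convex ℝ X) (hYne : Y.Nonempty)
    (hYcp : IsCompact Y) (hYco : Convex ℝ Y) (hφ : Continuous fun z : E × F => φ z.1 z.2)
    (hα : 0 < α) (hconv : ∀ y, StrongConvexOn univ α fun x => φ x y)
    (hconc : ∀ x, ConcaveOn ℝ univ fun y => φ x y) {γ : ℝ} (hγ : 0 < γ) {a z : E × F}
    (hz : z = resolventMap γ (minMaxOperator X Y φ) a) :
    ∃ w ∈ minMaxOperator X Y φ z, a = z + γ • w := by
  rw [hz]
  exact resolventMap_spec (exists_eq_add_smul_minMaxOperator hXne hXcl hXco hYne hYcp hYco hφ hα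
    hconv hconc hγ a)

/-- Both points are zeros of a strongly monotone operator. -/
lemma IsSaddle.eq [CompleteSpace E] [CompleteSpace F]
    (hXco : Convex ℝ X) (hYco : Convex ℝ Y) (hφ : Continuous fun z : E × F => φ z.1 z.2)
    (hα : 0 < α) (hconv : ∀ y, StrongConvexOn univ α fun x => φ x y)
    (hconc : ∀ x, StrongConcaveOn univ α fun y => φ x y) {z z' : E × F}
    (hz : IsSaddle X Y φ z) (hz' : IsSaddle X Y φ z') : z = z' := by
  have hconv' : ∀ y, ConvexOn ℝ univ fun x => φ x y :=
    fun y => ((hconv y).strictConvexOn hα).convexOn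
  have hconc' : ∀ x, ConcaveOn ℝ univ fun y => φ x y :=
    fun x => ((hconc x).strictConcaveOn hα).concaveOn
  have h := minMaxOperator_strongMono hconv hconc
    (zero_mem_minMaxOperator_of_isSaddle hXco hYco hφ hconv' hconc' hz)
    (zero_mem_minMaxOperator_of_isSaddle hXco hYco hφ hconv' hconc' hz')
  simp only [sub_self, inner_zero_left, add_zero, Prod.fst_zero, Prod.snd_zero] at h
  have h1 : ‖z.1 - z'.1‖ ^ 2 + ‖z.2 - z'.2‖ ^ 2 ≤ 0 := by
    by_contra! h2
    exact absurd (mul_pos hα h2) (not_lt.2 h)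
  have h2 : ‖z.1 - z'.1‖ = 0 := by
    apply pow_eq_zero_iff (two_ne_zero) |>.1
    nlinarith [sq_nonneg ‖z.1 - z'.1‖, sq_nonneg ‖z.2 - z'.2‖]
  have h3 : ‖z.2 - z'.2‖ = 0 := by
    apply pow_eq_zero_iff (two_ne_zero) |>.1
    nlinarith [sq_nonneg ‖z.1 - z'.1‖, sq_nonneg ‖z.2 - z'.2‖]
  exact Prod.ext (sub_eq_zero.1 (norm_eq_zero.1 h2)) (sub_eq_zero.1 (norm_eq_zero.1 h3))

/-- Contraction property of the resolvent of a strongly monotone operator, for the Euclidean norm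
of the product. -/
lemma norm_toLp_sub_le_of_minMaxOperator {γ : ℝ} (hγ : 0 < γ) (hα : 0 < α)
    (hconv : ∀ y, StrongConvexOn univ α fun x => φ x y)
    (hconc : ∀ x, StrongConcaveOn univ α fun y => φ x y) {z z' w w' : E × F}
    (hw : w ∈ minMaxOperator X Y φ z) (hw' : w' ∈ minMaxOperator X Y φ z') :
    ‖WithLp.toLp 2 (z - z')‖ ≤
      (1 + γ * α)⁻¹ * ‖WithLp.toLp 2 ((z + γ • w) - (z' + γ • w'))‖ := by
  have h := minMaxOperator_strongMono hconv hconc hw hw'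
  have h1 : (1 + γ * α) * ‖WithLp.toLp 2 (z - z')‖ ^ 2 ≤
      inner ℝ (WithLp.toLp 2 ((z + γ • w) - (z' + γ • w'))) (WithLp.toLp 2 (z - z')) := by
    have e : (z + γ • w) - (z' + γ • w') = (z - z') + γ • (w - w') := by module
    rw [e, WithLp.toLp_add, WithLp.toLp_smul, inner_add_left, real_inner_self_eq_norm_sq,
      real_inner_smul_left, WithLp.prod_norm_sq_eq_of_L2, WithLp.prod_inner_apply]
    change (1 + γ * α) * (‖z.1 - z'.1‖ ^ 2 + ‖z.2 - z'.2‖ ^ 2) ≤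
      ‖z.1 - z'.1‖ ^ 2 + ‖z.2 - z'.2‖ ^ 2 +
        γ * (inner ℝ (w.1 - w'.1) (z.1 - z'.1) + inner ℝ (w.2 - w'.2) (z.2 - z'.2))
    linarith [mul_le_mul_of_nonneg_left h hγ.le]
  have h2 := h1.trans (real_inner_le_norm _ _)
  have h3 : 0 < 1 + γ * α := by positivity
  rw [inv_mul_eq_div, le_div_iff₀ h3]
  rcases (norm_nonneg (WithLp.toLp 2 (z - z'))).eq_or_lt with h0 | h0
  · rw [← h0, zero_mul]; positivity
  · refine le_of_mul_le_mul_right ?_ h0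
    linarith

/-- The type `E × F` carries the maximum norm, whereas the contraction is Euclidean. Writing the
Euclidean norm through a linear isomorphism allows the fixed-point results to work with `‖L ·‖` for
an arbitrary `L`. -/
lemma norm_prodEquiv_symm_sub_le_of_minMaxOperator {γ : ℝ} (hγ : 0 < γ) (hα : 0 < α)
    (hconv : ∀ y, StrongConvexOn univ α fun x => φ x y)
    (hconc : ∀ x, StrongConcaveOn univ α fun y => φ x y) {z z' w w' a a' : E × F}
    (ha : a ∈ minMaxOperator X Y φ z) (ha' : a' ∈ minMaxOperator X Y φ z')
    (hw : w = z + γ • a) (hw' : w' = z' + γ • a') :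
    ‖(WithLp.prodContinuousLinearEquiv 2 ℝ E F).symm (z - z')‖ ≤
      (1 + γ * α)⁻¹ * ‖(WithLp.prodContinuousLinearEquiv 2 ℝ E F).symm (w - w')‖ := by
  rw [hw, hw']
  exact norm_toLp_sub_le_of_minMaxOperator hγ hα hconv hconc ha ha'

end MinMaxOperator

/-! ### Absolutely continuous curves. -/

section AbsolutelyContinuous

lemma AbsolutelyContinuousOnInterval.comp_lipschitzOnWith {X Y : Type*} [PseudoMetricSpace X]
    [PseudoMetricSpace Y] {f : ℝ → X} {a b : ℝ} (hf : AbsolutelyContinuousOnInterval f a b)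
    {g : X → Y} {K : NNReal} (hg : LipschitzOnWith K g (f '' uIcc a b)) :
    AbsolutelyContinuousOnInterval (fun t => g (f t)) a b := by
  refine squeeze_zero' (Eventually.of_forall fun t => Finset.sum_nonneg fun _ _ => dist_nonneg) ?_
    (by simpa using Tendsto.const_mul (K : ℝ) hf)
  filter_upwards [mem_inf_of_right (mem_principal_self _)] with I hI
  rw [Finset.mul_sum]
  exact Finset.sum_le_sum fun i hi => hg.dist_le_mul _ (mem_image_of_mem _ (hI.1 i hi).1) _
    (mem_image_of_mem _ (hI.1 i hi).2)

lemma AbsolutelyContinuousOnInterval.prodMk {X Y : Type*} [PseudoMetricSpace X]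
    [PseudoMetricSpace Y] {f : ℝ → X} {g : ℝ → Y} {a b : ℝ}
    (hf : AbsolutelyContinuousOnInterval f a b) (hg : AbsolutelyContinuousOnInterval g a b) :
    AbsolutelyContinuousOnInterval (fun t => (f t, g t)) a b := by
  refine squeeze_zero (fun t => Finset.sum_nonneg fun _ _ => dist_nonneg) (fun I => ?_)
    (by simpa using Tendsto.add hf hg)
  rw [← Finset.sum_add_distrib]
  exact Finset.sum_le_sum fun i _ => by
    rw [Prod.dist_eq]
    exact max_le_add_of_nonneg dist_nonneg dist_nonneg

/-- Mean value inequality for absolutely continuous curves. -/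
lemma AbsolutelyContinuousOnInterval.norm_sub_le_of_ae_hasDerivAt {F : Type*}
    [NormedAddCommGroup F] [NormedSpace ℝ F] {g : ℝ → F} {ε : ℝ}
    (hg : AbsolutelyContinuousOnInterval g 0 1)
    (h : ∀ᵐ t ∂(volume.restrict (Icc (0 : ℝ) 1)), ∃ d, HasDerivAt g d t ∧ ‖d‖ ≤ ε) :
    ‖g 1 - g 0‖ ≤ ε := by
  -- A norming functional reduces the claim to the fundamental theorem of calculus for a scalar
  -- function.
  obtain ⟨l, hl1, hl2⟩ := exists_dual_vector'' ℝ (g 1 - g 0)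
  have hac : AbsolutelyContinuousOnInterval (fun t => l (g t)) 0 1 :=
    hg.comp_lipschitzOnWith (l.lipschitz.lipschitzOnWith)
  have hint := hac.integral_deriv_eq_sub
  have hbound : ∀ᵐ t, t ∈ uIoc (0 : ℝ) 1 → ‖deriv (fun t => l (g t)) t‖ ≤ ε := by
    filter_upwards [(ae_restrict_iff' measurableSet_Icc).1 h] with t ht hmem
    rw [uIoc_of_le zero_le_one] at hmem
    obtain ⟨d, hd, hdε⟩ := ht ⟨hmem.1.le, hmem.2⟩
    have hld : HasDerivAt (fun t => l (g t)) (l d) t := l.hasFDerivAt.comp_hasDerivAt t hd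
    rw [hld.deriv]
    exact (l.le_opNorm d).trans ((mul_le_of_le_one_left (norm_nonneg d) hl1).trans hdε)
  have := intervalIntegral.norm_integral_le_of_norm_le_const_ae hbound
  rw [hint, ← map_sub, hl2] at this
  simpa using this

lemma AbsolutelyContinuousOnInterval.ae_differentiableAt_of_finiteDimensional {F : Type*}
    [NormedAddCommGroup F] [NormedSpace ℝ F] [FiniteDimensional ℝ F] {g : ℝ → F}
    (hg : AbsolutelyContinuousOnInterval g 0 1) :
    ∀ᵐ t ∂(volume.restrict (Icc (0 : ℝ) 1)), DifferentiableAt ℝ g t := by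
  rw [ae_restrict_iff' measurableSet_Icc]
  filter_upwards [hg.boundedVariationOn.ae_differentiableAt_of_mem_uIcc] with t ht hmem
  exact ht (by rwa [uIcc_of_le zero_le_one])

end AbsolutelyContinuous

/-! ### Set-valued maps, compact convex hulls and local Lipschitz bounds. -/

/-- A locally bounded set-valued map with closed graph and values in a proper space is upper
semicontinuous. -/
lemma eventually_subset_of_closedGraph {E G : Type*} [TopologicalSpace E] [NormedAddCommGroup G]
    [ProperSpace G] {U : Set E} {J : E → Set G} {x : E}
    (hb : ∃ C : ℝ, ∀ᶠ y in 𝓝[U] x, ∀ u ∈ J y, ‖u‖ ≤ C)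
    (hcl : ∀ u, (x, u) ∈ closure {q : E × G | q.1 ∈ U ∧ q.2 ∈ J q.1} → u ∈ J x)
    {V : Set G} (hV : IsOpen V) (hJV : J x ⊆ V) : ∀ᶠ y in 𝓝[U] x, J y ⊆ V := by
  obtain ⟨C, hC⟩ := hb
  -- Near `x` the values of `J` lie in the ball, so they can leave `V` only through this compact
  -- set. Each of its points has a neighbourhood missed by the graph near `x`, and compactness makes
  -- this uniform.
  have hK : IsCompact (Metric.closedBall (0 : G) C \ V) := (isCompact_closedBall 0 C).diff hV
  have h := hK.eventually_forall_of_forall_eventually (x₀ := x)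
    (P := fun y u => ¬ (y ∈ U ∧ u ∈ J y)) fun u hu => by
      have : (x, u) ∉ closure {q : E × G | q.1 ∈ U ∧ q.2 ∈ J q.1} := fun h => hu.2 (hJV (hcl u h))
      exact not_frequently.1 (mt mem_closure_iff_frequently.2 this)
  filter_upwards [hC, nhdsWithin_le_nhds h, self_mem_nhdsWithin] with y h1 h2 h3 u hu
  by_contra hn
  exact h2 u ⟨by simpa using h1 u hu, hn⟩ ⟨h3, hu⟩

/-- The convex hull of a compact set in a finite-dimensional space is compact. -/
lemma IsCompact.convexHull_of_finiteDimensional {G : Type*} [NormedAddCommGroup G]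
    [NormedSpace ℝ G] [FiniteDimensional ℝ G] {K : Set G} (hK : IsCompact K) :
    IsCompact (convexHull ℝ K) := by
  -- By Carathéodory, boundedly many points suffice, so the hull is a finite union of continuous
  -- images of compact sets.
  have heq : convexHull ℝ K = ⋃ k ∈ Iic (Module.finrank ℝ G + 1),
      (fun q : (Fin k → ℝ) × (Fin k → G) => ∑ i, q.1 i • q.2 i) ''
        (stdSimplex ℝ (Fin k) ×ˢ univ.pi fun _ => K) := by
    apply Subset.antisymm
    · intro x hx
      obtain ⟨ι, _, z, w, hz, hai, hw, hw1, rfl⟩ := eq_pos_convex_span_of_mem_convexHull hx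
      have hcard := hai.card_le_finrank_succ
      refine mem_iUnion₂.2 ⟨Fintype.card ι, ?_, ?_⟩
      · exact hcard.trans (Nat.succ_le_succ (Submodule.finrank_le _))
      · let e := (Fintype.equivFin ι).symm
        refine ⟨(w ∘ e, z ∘ e), ⟨⟨fun i => (hw _).le, ?_⟩, fun i _ => hz (mem_range_self _)⟩, ?_⟩
        · simpa using (e.sum_comp w).trans hw1
        · exact e.sum_comp fun i => w i • z i
    · refine iUnion₂_subset fun k _ => ?_
      rintro _ ⟨⟨w, z⟩, ⟨⟨h1, h2⟩, h3⟩, rfl⟩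
      exact (convex_convexHull ℝ K).sum_mem (fun i _ => h1 i) h2
        fun i _ => subset_convexHull ℝ K (h3 i (mem_univ i))
  rw [heq]
  refine (finite_Iic _).isCompact_biUnion fun k _ => ?_
  exact ((isCompact_stdSimplex ℝ _).prod (isCompact_univ_pi fun _ => hK)).image (by fun_prop)

lemma LocallyLipschitzOn.exists_lipschitzOnWith_mem_nhds {E F : Type*} [PseudoEMetricSpace E]
    [PseudoEMetricSpace F] {U : Set E} {f : E → F} {x : E} (hU : IsOpen U)
    (hf : LocallyLipschitzOn U f) (hx : x ∈ U) :
    ∃ K, ∃ t ∈ 𝓝 x, t ⊆ U ∧ LipschitzOnWith K f t := by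
  obtain ⟨K, t, ht, hK⟩ := hf hx
  rw [hU.nhdsWithin_eq hx] at ht
  exact ⟨K, t ∩ U, inter_mem ht (hU.mem_nhds hx), inter_subset_right, hK.mono inter_subset_left⟩

/-! ### The Clarke Jacobian and its comparison with a conservative Jacobian. -/

section Clarke

variable {E F : Type*} [NormedAddCommGroup E] [NormedSpace ℝ E]
    [NormedAddCommGroup F] [NormedSpace ℝ F] {U : Set E} {f : E → F} {x : E}

/-- The set of limits of derivatives of `f` at differentiability points converging to `x`. -/
def limitingJacobian (f : E → F) (x : E) : Set (E →L[ℝ] F) :=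
  {M | ∃ s : ℕ → E, (∀ k, DifferentiableAt ℝ f (s k)) ∧
    Tendsto s atTop (𝓝 x) ∧ Tendsto (fun k => fderiv ℝ f (s k)) atTop (𝓝 M)}

lemma mem_limitingJacobian_iff {M : E →L[ℝ] F} : M ∈ limitingJacobian f x ↔
    (x, M) ∈ closure ((fun y => (y, fderiv ℝ f y)) '' {y | DifferentiableAt ℝ f y}) := by
  rw [mem_closure_iff_seq_limit]
  constructor
  · rintro ⟨s, h1, h2, h3⟩
    exact ⟨_, fun k => mem_image_of_mem _ (h1 k), h2.prodMk_nhds h3⟩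
  · rintro ⟨q, h1, h2⟩
    choose s h3 h4 using h1
    obtain rfl : (fun k => (s k, fderiv ℝ f (s k))) = q := funext h4
    exact ⟨s, h3, (continuous_fst.tendsto _).comp h2, (continuous_snd.tendsto _).comp h2⟩

lemma isClosed_graph_limitingJacobian :
    IsClosed {q : E × (E →L[ℝ] F) | q.2 ∈ limitingJacobian f q.1} := by
  have : {q : E × (E →L[ℝ] F) | q.2 ∈ limitingJacobian f q.1} =
      closure ((fun y => (y, fderiv ℝ f y)) '' {y | DifferentiableAt ℝ f y}) :=
    ext fun q => mem_limitingJacobian_iff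
  rw [this]
  exact isClosed_closure

lemma limitingJacobian_subset_of_eventually {S : Set (E →L[ℝ] F)} (hS : IsClosed S)
    (h : ∀ᶠ y in 𝓝 x, DifferentiableAt ℝ f y → fderiv ℝ f y ∈ S) :
    limitingJacobian f x ⊆ S := by
  rintro M ⟨s, h1, h2, h3⟩
  exact hS.mem_of_tendsto h3 ((h2.eventually h).mono fun k hk => hk (h1 k))

lemma exists_eventually_norm_fderiv_le (hU : IsOpen U) (hf : LocallyLipschitzOn U f) (hx : x ∈ U) :
    ∃ C : ℝ, ∀ᶠ y in 𝓝 x, DifferentiableAt ℝ f y → ‖fderiv ℝ f y‖ ≤ C := by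
  obtain ⟨K, t, ht, -, hK⟩ := hf.exists_lipschitzOnWith_mem_nhds hU hx
  refine ⟨K, ?_⟩
  filter_upwards [eventually_mem_nhds_iff.2 ht] with y hy hd
  exact hd.hasFDerivAt.le_of_lipschitzOn hy hK

lemma exists_eventually_norm_clarkeJacobian_le (hU : IsOpen U) (hf : LocallyLipschitzOn U f)
    (hx : x ∈ U) : ∃ C : ℝ, ∀ᶠ y in 𝓝 x, ∀ M ∈ clarkeJacobian f y, ‖M‖ ≤ C := by
  obtain ⟨C, hC⟩ := exists_eventually_norm_fderiv_le hU hf hx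
  refine ⟨C, ?_⟩
  filter_upwards [eventually_eventually_nhds.2 hC] with y hy M hM
  have : clarkeJacobian f y ⊆ Metric.closedBall 0 C :=
    convexHull_min (limitingJacobian_subset_of_eventually Metric.isClosed_closedBall
      (by simpa using hy)) (convex_closedBall _ _)
  simpa using this hM

variable [FiniteDimensional ℝ E] [FiniteDimensional ℝ F]

/-- Rademacher's theorem gives differentiability points converging to `x`; their derivatives are
bounded by the Lipschitz constant, so a subsequence converges. -/
lemma limitingJacobian_nonempty (hU : IsOpen U) (hf : LocallyLipschitzOn U f) (hx : x ∈ U) :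
    (limitingJacobian f x).Nonempty := by
  have : ProperSpace (E →L[ℝ] F) := FiniteDimensional.proper ℝ _
  let _ : MeasurableSpace E := borel E
  have : BorelSpace E := ⟨rfl⟩
  obtain ⟨K, t, ht, -, hK⟩ := hf.exists_lipschitzOnWith_mem_nhds hU hx
  have hd := Measure.dense_of_ae
    ((hK.mono interior_subset).ae_differentiableWithinAt_of_mem (μ := Measure.addHaar))
  have hxc : x ∈ closure {y | DifferentiableAt ℝ f y} := by
    refine closure_mono ?_ (hd.open_subset_closure_inter isOpen_interior
      (mem_interior_iff_mem_nhds.2 ht))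
    rintro y ⟨hy1, hy2⟩
    exact (hy2 hy1).differentiableAt (isOpen_interior.mem_nhds hy1)
  obtain ⟨s, hs1, hs2⟩ := mem_closure_iff_seq_limit.1 hxc
  obtain ⟨C, hC⟩ := exists_eventually_norm_fderiv_le hU hf hx
  have hev : ∃ᶠ k in atTop, fderiv ℝ f (s k) ∈ Metric.closedBall (0 : E →L[ℝ] F) C :=
    ((hs2.eventually hC).mono fun k hk => by simpa using hk (hs1 k)).frequently
  obtain ⟨M, -, φ, hφ, hM⟩ := tendsto_subseq_of_frequently_bounded Metric.isBounded_closedBall hev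
  exact ⟨M, s ∘ φ, fun k => hs1 _, hs2.comp hφ.tendsto_atTop, hM⟩

lemma clarkeJacobian_nonempty (hU : IsOpen U) (hf : LocallyLipschitzOn U f) (hx : x ∈ U) :
    (clarkeJacobian f x).Nonempty :=
  (limitingJacobian_nonempty hU hf hx).convexHull

lemma isCompact_clarkeJacobian (hU : IsOpen U) (hf : LocallyLipschitzOn U f) (hx : x ∈ U) :
    IsCompact (clarkeJacobian f x) := by
  have : ProperSpace (E →L[ℝ] F) := FiniteDimensional.proper ℝ _
  refine IsCompact.convexHull_of_finiteDimensional (Metric.isCompact_of_isClosed_isBounded ?_ ?_)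
  · exact isClosed_graph_limitingJacobian.preimage (by fun_prop : Continuous fun M => (x, M))
  · obtain ⟨C, hC⟩ := exists_eventually_norm_clarkeJacobian_le hU hf hx
    exact Metric.isBounded_closedBall.subset fun M hM =>
      mem_closedBall_zero_iff.2 (hC.self_of_nhds M (subset_convexHull ℝ _ hM))

/-- The limiting Jacobians near `x` lie in an `ε`-thickening of the Clarke Jacobian at `x`. The
thickening is convex, so it also contains their hulls; closedness then lets `ε` tend to `0`. -/
lemma mem_clarkeJacobian_of_mem_closure (hU : IsOpen U) (hf : LocallyLipschitzOn U f) (hx : x ∈ U)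
    {u : E →L[ℝ] F} (hu : (x, u) ∈ closure {q : E × (E →L[ℝ] F) | q.2 ∈ clarkeJacobian f q.1}) :
    u ∈ clarkeJacobian f x := by
  have : ProperSpace (E →L[ℝ] F) := FiniteDimensional.proper ℝ _
  rw [← (isCompact_clarkeJacobian hU hf hx).isClosed.closure_eq,
    Metric.closure_eq_iInter_cthickening]
  refine mem_iInter₂.2 fun ε hε => ?_
  obtain ⟨C, hC⟩ := exists_eventually_norm_clarkeJacobian_le hU hf hx
  have h : ∀ᶠ y in 𝓝[univ] x,
      limitingJacobian f y ⊆ Metric.thickening ε (clarkeJacobian f x) := by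
    refine eventually_subset_of_closedGraph ⟨C, ?_⟩ (fun v hv => ?_) Metric.isOpen_thickening
      ((subset_convexHull ℝ _).trans (Metric.self_subset_thickening hε _))
    · rw [nhdsWithin_univ]
      exact hC.mono fun y hy M hM => hy M (subset_convexHull ℝ _ hM)
    · simp only [mem_univ, true_and, isClosed_graph_limitingJacobian.closure_eq] at hv
      exact hv
  rw [nhdsWithin_univ] at h
  refine Metric.closure_thickening_subset_cthickening _ _
    (mem_closure_of_frequently_of_tendsto (f := Prod.snd) ?_ (continuous_snd.tendsto (x, u)))
  refine ((mem_closure_iff_frequently.1 hu).and_eventually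
    ((continuous_fst.tendsto (x, u)).eventually h)).mono fun q hq => ?_
  exact convexHull_min hq.2 ((convex_convexHull ℝ _).thickening ε) hq.1

/-- A conservative Jacobian that is single valued in a direction determines the Clarke Jacobian
in that direction. -/
lemma IsConservativeJacobianOn.clarkeJacobian_apply_eq {J : E → Set (E →L[ℝ] F)} (hU : IsOpen U)
    (hf : LocallyLipschitzOn U f) (hJ : IsConservativeJacobianOn U f J) (hx : x ∈ U) {v : E}
    {w : F} (hw : ∀ u ∈ J x, u v = w) {M : E →L[ℝ] F} (hM : M ∈ clarkeJacobian f x) :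
    M v = w := by
  have : ProperSpace (E →L[ℝ] F) := FiniteDimensional.proper ℝ _
  have hbound : ∀ ε > 0, ∀ᶠ y in 𝓝 x, DifferentiableAt ℝ f y → ‖fderiv ℝ f y v - w‖ ≤ ε := by
    intro ε hε
    have husc := eventually_subset_of_closedGraph (hJ.locallyBounded x hx) (hJ.closedGraph x hx)
      (V := {u | ‖u v - w‖ < ε}) (isOpen_lt (by fun_prop) continuous_const)
      fun u hu => by simpa [hw u hu] using hε
    rw [hU.nhdsWithin_eq hx] at husc
    obtain ⟨δ, hδ, hball⟩ := Metric.eventually_nhds_iff_ball.1 (husc.and (hU.mem_nhds hx))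
    filter_upwards [Metric.ball_mem_nhds x hδ] with y hy hd
    -- On the segment from `y` to `y + tv`, every element of `J` sends `v` within `ε` of `w`. The
    -- mean value inequality for `s ↦ f(c s) - s t w` transfers this bound to difference quotients.
    have hlip : ∀ t : ℝ, y + t • v ∈ Metric.ball x δ →
        ‖f (y + t • v) - f y - t • w‖ ≤ |t| * ε := by
      intro t ht
      set c : ℝ → E := fun s => y + s • t • v with hc
      have hcU : ∀ s ∈ Icc (0 : ℝ) 1, c s ∈ Metric.ball x δ := fun s hs => by
        have := (convex_ball x δ).add_smul_mem hy ht hs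
        exact this
      have hcd : ∀ s, HasDerivAt c (t • v) s := fun s => by
        simpa [hc] using ((hasDerivAt_id s).smul_const (t • v)).const_add y
      have hcac : AbsolutelyContinuousOnInterval c 0 1 :=
        ContDiffOn.absolutelyContinuousOnInterval (by fun_prop)
      obtain ⟨K, hK⟩ := LocallyLipschitzOn.exists_lipschitzOnWith_of_compact
        (s := c '' uIcc 0 1) (isCompact_uIcc.image_of_continuousOn hcac.continuousOn)
        (hf.mono (by
          rintro _ ⟨s, hs, rfl⟩
          rw [uIcc_of_le zero_le_one] at hs
          exact (hball _ (hcU s hs)).2))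
      have hlin : AbsolutelyContinuousOnInterval (fun s : ℝ => s • t • w) 0 1 :=
        ContDiffOn.absolutelyContinuousOnInterval (by fun_prop)
      have hmv := ((hcac.comp_lipschitzOnWith hK).sub hlin).norm_sub_le_of_ae_hasDerivAt
        (ε := |t| * ε) (by
        filter_upwards [hJ.chainRule c hcac fun s hs => (hball _ (hcU s hs)).2,
          ae_restrict_mem measurableSet_Icc] with s hs hmem
        obtain ⟨u, hu⟩ := hJ.nonempty _ (hball _ (hcU s hmem)).2
        have h1 := (hs u hu).sub ((hasDerivAt_id s).smul_const (t • w))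
        refine ⟨_, h1, ?_⟩
        rw [(hcd s).deriv, map_smul, one_smul, ← smul_sub, norm_smul, Real.norm_eq_abs]
        exact mul_le_mul_of_nonneg_left ((hball _ (hcU s hmem)).1 hu).le (abs_nonneg t))
      have e : f (y + t • v) - f y - t • w = ((fun s => f (c s)) - fun s : ℝ => s • t • w) 1 -
          ((fun s => f (c s)) - fun s : ℝ => s • t • w) 0 := by
        simp only [Pi.sub_apply, hc, one_smul, zero_smul, add_zero, sub_zero]
        abel
      rw [e]
      exact hmv
    have hline : HasDerivAt (fun t : ℝ => f (y + t • v)) (fderiv ℝ f y v) 0 := by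
      have h1 : HasDerivAt (fun t : ℝ => y + t • v) v 0 := by
        simpa using ((hasDerivAt_id (0 : ℝ)).smul_const v).const_add y
      have h2 : HasFDerivAt f (fderiv ℝ f y) (y + (0 : ℝ) • v) := by simpa using hd.hasFDerivAt
      exact h2.comp_hasDerivAt (0 : ℝ) h1
    have hslope := hasDerivAt_iff_tendsto_slope_zero.1 hline
    refine le_of_tendsto (hslope.sub_const w).norm ?_
    have hnear : ∀ᶠ t : ℝ in 𝓝 0, y + t • v ∈ Metric.ball x δ := by
      have : Continuous fun t : ℝ => y + t • v := by fun_prop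
      exact this.continuousAt.eventually_mem (Metric.isOpen_ball.mem_nhds (by simpa using hy))
    filter_upwards [nhdsWithin_le_nhds hnear, self_mem_nhdsWithin] with t ht ht0
    have ht0' : 0 < |t| := abs_pos.2 ht0
    have h1 := hlip t ht
    have h3 : ‖t⁻¹ • (f (y + t • v) - f y - t • w)‖ ≤ ε := by
      rw [norm_smul, norm_inv, Real.norm_eq_abs, inv_mul_le_iff₀ ht0']
      exact h1
    simpa [smul_sub, inv_smul_smul₀ (show t ≠ 0 from ht0)] using h3
  have hlim : ∀ M ∈ limitingJacobian f x, M v = w := by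
    intro M hM
    rw [← sub_eq_zero, ← norm_le_zero_iff]
    refine le_of_forall_pos_le_add fun ε hε => ?_
    rw [zero_add]
    exact limitingJacobian_subset_of_eventually (S := {M | ‖M v - w‖ ≤ ε})
      (isClosed_le (by fun_prop) continuous_const) (hbound ε hε) hM
  have hconv : Convex ℝ {M : E →L[ℝ] F | M v = w} := by
    intro M₁ h₁ M₂ h₂ a b _ _ hab
    simp only [mem_ofPred_eq] at h₁ h₂
    simp [h₁, h₂, ← add_smul, hab]
  exact convexHull_min hlim hconv hM

/-- The Clarke Jacobian of a path differentiable function is a conservative Jacobian. -/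
theorem PathDifferentiableOn.isConservativeJacobianOn_clarkeJacobian (hU : IsOpen U)
    (hf : PathDifferentiableOn U f) : IsConservativeJacobianOn U f (clarkeJacobian f) := by
  obtain ⟨hlip, J, hJ⟩ := hf
  refine ⟨fun x hx => clarkeJacobian_nonempty hU hlip hx, fun x hx => ?_, fun x hx u hu => ?_,
    fun c hc hcU => ?_⟩
  · obtain ⟨C, hC⟩ := exists_eventually_norm_clarkeJacobian_le hU hlip hx
    exact ⟨C, nhdsWithin_le_nhds hC⟩
  · exact mem_clarkeJacobian_of_mem_closure hU hlip hx (closure_mono (fun q hq => hq.2) hu)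
  · filter_upwards [hJ.chainRule c hc hcU, ae_restrict_mem measurableSet_Icc] with t ht hmem M hM
    obtain ⟨u, hu⟩ := hJ.nonempty _ (hcU t hmem)
    -- By uniqueness of derivatives, all elements of `J (c t)` take the same value on the velocity.
    rw [hJ.clarkeJacobian_apply_eq hU hlip (hcU t hmem)
      (fun u' hu' => (ht u' hu').unique (ht u hu)) hM]
    exact ht u hu

end Clarke

/-! ### Implicit differentiation of fixed points of contractions. -/

section FixedPoint

variable {E G H : Type*} [NormedAddCommGroup E] [NormedSpace ℝ E]
  [NormedAddCommGroup G] [NormedSpace ℝ G] [NormedAddCommGroup H] [NormedSpace ℝ H]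
  {U : Set E} {T : E × G → G} {L : G ≃L[ℝ] H} {κ : ℝ} {zstar : E → G}

/-- The contraction bound passes to difference quotients in the direction `(0, h)`, and the
condition it puts on `M` is closed and convex. -/
lemma norm_apply_inr_le_of_mem_clarkeJacobian (hU : IsOpen U)
    (hTκ : ∀ θ ∈ U, ∀ z z', ‖L (T (θ, z) - T (θ, z'))‖ ≤ κ * ‖L (z - z')‖) {q : E × G}
    (hq : q.1 ∈ U) {M : E × G →L[ℝ] G} (hM : M ∈ clarkeJacobian T q) (h : G) :
    ‖L (M (0, h))‖ ≤ κ * ‖L h‖ := by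
  have hconv : Convex ℝ {M : E × G →L[ℝ] G | ‖L (M (0, h))‖ ≤ κ * ‖L h‖} := by
    intro M₁ h₁ M₂ h₂ a b ha hb hab
    simp only [mem_ofPred_eq] at h₁ h₂ ⊢
    calc ‖L ((a • M₁ + b • M₂) (0, h))‖ = ‖a • L (M₁ (0, h)) + b • L (M₂ (0, h))‖ := by simp
      _ ≤ a * ‖L (M₁ (0, h))‖ + b * ‖L (M₂ (0, h))‖ := by
        refine (norm_add_le _ _).trans_eq ?_
        rw [norm_smul, norm_smul, Real.norm_of_nonneg ha, Real.norm_of_nonneg hb]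
      _ ≤ a * (κ * ‖L h‖) + b * (κ * ‖L h‖) := by gcongr
      _ = κ * ‖L h‖ := by rw [← add_mul, hab, one_mul]
  refine convexHull_min (limitingJacobian_subset_of_eventually
    (isClosed_le (by fun_prop) continuous_const) ?_) hconv hM
  filter_upwards [(hU.preimage continuous_fst).mem_nhds hq] with y hy hd
  have hline : HasDerivAt (fun t : ℝ => T (y + t • (0, h))) (fderiv ℝ T y (0, h)) 0 := by
    have h1 : HasDerivAt (fun t : ℝ => y + t • ((0, h) : E × G)) (0, h) 0 := by
      simpa using ((hasDerivAt_id (0 : ℝ)).smul_const ((0, h) : E × G)).const_add y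
    have h2 : HasFDerivAt T (fderiv ℝ T y) (y + (0 : ℝ) • ((0, h) : E × G)) := by
      simpa using hd.hasFDerivAt
    exact h2.comp_hasDerivAt (0 : ℝ) h1
  have hslope := hasDerivAt_iff_tendsto_slope_zero.1 hline
  refine le_of_tendsto ((L.continuous.tendsto _).comp hslope).norm ?_
  filter_upwards [self_mem_nhdsWithin] with t ht
  have h1 := hTκ y.1 hy (y.2 + t • h) y.2
  have e1 : y + t • ((0, h) : E × G) = (y.1, y.2 + t • h) := Prod.ext (by simp) (by simp)
  simp only [Function.comp_apply, zero_add, zero_smul, add_zero, e1]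
  rw [map_smul, norm_smul, norm_inv, inv_mul_le_iff₀ (norm_pos_iff.2 ht)]
  rw [add_sub_cancel_left, map_smul, norm_smul] at h1
  linarith

/-- A fixed vector `h` of `V` satisfies `‖L h‖ ≤ κ‖L h‖` and vanishes; in finite dimension
injectivity suffices. -/
lemma isUnit_one_sub_of_contraction [FiniteDimensional ℝ G] (hκ : κ < 1) {V : G →L[ℝ] G}
    (hV : ∀ h, ‖L (V h)‖ ≤ κ * ‖L h‖) : IsUnit (1 - V) := by
  have := FiniteDimensional.complete ℝ G
  have hinj : Function.Injective (1 - V : G →L[ℝ] G) := by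
    rw [injective_iff_map_eq_zero]
    intro h hh
    have hh : V h = h := by
      exact (sub_eq_zero.1 (show h - V h = 0 from hh)).symm
    have h1 := hV h
    rw [hh] at h1
    have h2 : ‖L h‖ = 0 := by nlinarith [norm_nonneg (L h)]
    simpa using h2
  exact ContinuousLinearMap.isUnit_iff_bijective.2
    ⟨hinj, (LinearMap.injective_iff_surjective (f := ((1 - V : G →L[ℝ] G) : G →ₗ[ℝ] G))).1 hinj⟩

/-- Inserting `T(θ, z(θ'))` splits the difference into a part absorbed by contraction and a part
varying only in `θ`. The right side does not involve `z(θ)`, so it yields continuity before any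
Lipschitz bound is known. -/
lemma norm_sub_fixedPoint_le {E : Type*} {U : Set E} {T : E × G → G} {zstar : E → G} (hκ : κ < 1)
    (hTκ : ∀ θ ∈ U, ∀ z z', ‖L (T (θ, z) - T (θ, z'))‖ ≤ κ * ‖L (z - z')‖)
    (hz : ∀ θ ∈ U, T (θ, zstar θ) = zstar θ) {θ θ' : E} (hθ : θ ∈ U) (hθ' : θ' ∈ U) :
    ‖L (zstar θ - zstar θ')‖ ≤ (1 - κ)⁻¹ * ‖L (T (θ, zstar θ') - T (θ', zstar θ'))‖ := by
  have h1 : zstar θ - zstar θ' = (T (θ, zstar θ) - T (θ, zstar θ')) +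
      (T (θ, zstar θ') - T (θ', zstar θ')) := by
    rw [hz θ hθ, hz θ' hθ']
    abel
  have h2 := hTκ θ hθ (zstar θ) (zstar θ')
  have h3 : ‖L (zstar θ - zstar θ')‖ ≤ ‖L (T (θ, zstar θ) - T (θ, zstar θ'))‖ +
      ‖L (T (θ, zstar θ') - T (θ', zstar θ'))‖ := by
    conv_lhs => rw [h1, map_add]
    exact norm_add_le _ _
  rw [inv_mul_eq_div, le_div_iff₀ (by linarith)]
  linarith

lemma continuousAt_fixedPoint {E : Type*} [NormedAddCommGroup E] {U : Set E} {T : E × G → G}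
    {zstar : E → G} (hU : IsOpen U) (hκ : κ < 1)
    (hTκ : ∀ θ ∈ U, ∀ z z', ‖L (T (θ, z) - T (θ, z'))‖ ≤ κ * ‖L (z - z')‖)
    (hz : ∀ θ ∈ U, T (θ, zstar θ) = zstar θ) (hT : LocallyLipschitzOn (U ×ˢ univ) T)
    {θ : E} (hθ : θ ∈ U) : ContinuousAt zstar θ := by
  have hTc : ContinuousAt T (θ, zstar θ) :=
    hT.continuousOn.continuousAt ((hU.prod isOpen_univ).mem_nhds ⟨hθ, mem_univ _⟩)
  have h1 : Tendsto (fun θ' => T (θ', zstar θ)) (𝓝 θ) (𝓝 (T (θ, zstar θ))) :=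
    hTc.tendsto.comp ((by fun_prop : Continuous fun θ' : E => (θ', zstar θ)).tendsto θ)
  have h2 : Tendsto (fun θ' => (1 - κ)⁻¹ * ‖L (T (θ', zstar θ) - T (θ, zstar θ))‖) (𝓝 θ) (𝓝 0) := by
    have := ((L.continuous.tendsto _).comp (h1.sub_const (T (θ, zstar θ)))).norm.const_mul (1 - κ)⁻¹
    simpa using this
  have h3 : Tendsto (fun θ' => L (zstar θ' - zstar θ)) (𝓝 θ) (𝓝 0) := by
    refine squeeze_zero_norm' ?_ h2
    filter_upwards [hU.mem_nhds hθ] with θ' hθ'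
    exact norm_sub_fixedPoint_le hκ hTκ hz hθ' hθ
  have h4 := (L.symm.continuous.tendsto 0).comp h3
  simp only [Function.comp_def, ContinuousLinearEquiv.symm_apply_apply, map_zero] at h4
  have h5 := h4.add_const (zstar θ)
  simp only [sub_add_cancel, zero_add] at h5
  exact h5

/-- Continuity keeps the graph of `zstar` inside a neighbourhood on which `T` is Lipschitz. -/
lemma locallyLipschitzOn_fixedPoint {E : Type*} [NormedAddCommGroup E] {U : Set E}
    {T : E × G → G} {zstar : E → G} (hU : IsOpen U) (hκ : κ < 1)
    (hTκ : ∀ θ ∈ U, ∀ z z', ‖L (T (θ, z) - T (θ, z'))‖ ≤ κ * ‖L (z - z')‖)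
    (hz : ∀ θ ∈ U, T (θ, zstar θ) = zstar θ) (hT : LocallyLipschitzOn (U ×ˢ univ) T) :
    LocallyLipschitzOn U zstar := by
  intro θ hθ
  obtain ⟨K, t, ht, -, hK⟩ := hT.exists_lipschitzOnWith_mem_nhds (hU.prod isOpen_univ)
    (x := (θ, zstar θ)) ⟨hθ, mem_univ _⟩
  obtain ⟨a, ha, b, hb, hab⟩ := mem_nhds_prod_iff.1 ht
  refine ⟨_, _, nhdsWithin_le_nhds (inter_mem (inter_mem (hU.mem_nhds hθ) ha)
    (continuousAt_fixedPoint hU hκ hTκ hz hT hθ hb)), LipschitzOnWith.of_dist_le'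
      (K := ‖(L.symm : H →L[ℝ] G)‖ * ((1 - κ)⁻¹ * (‖(L : G →L[ℝ] H)‖ * K))) ?_⟩
  rintro θ₁ ⟨⟨h1, h1a⟩, -⟩ θ₂ ⟨⟨h2, h2a⟩, h2b⟩
  have hκ' : 0 ≤ (1 - κ)⁻¹ := inv_nonneg.2 (by linarith)
  have hlip := hK.dist_le_mul (θ₁, zstar θ₂) (hab ⟨h1a, h2b⟩) (θ₂, zstar θ₂) (hab ⟨h2a, h2b⟩)
  rw [dist_prod_same_right, dist_eq_norm] at hlip
  have e : dist (zstar θ₁) (zstar θ₂) = ‖(L.symm : H →L[ℝ] G) (L (zstar θ₁ - zstar θ₂))‖ := by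
    simp [dist_eq_norm]
  rw [e, mul_assoc, mul_assoc, mul_assoc]
  refine (ContinuousLinearMap.le_opNorm _ _).trans (mul_le_mul_of_nonneg_left ?_ (norm_nonneg _))
  refine (norm_sub_fixedPoint_le hκ hTκ hz h1 h2).trans (mul_le_mul_of_nonneg_left ?_ hκ')
  exact ((L : G →L[ℝ] H).le_opNorm _).trans (mul_le_mul_of_nonneg_left hlip (norm_nonneg _))

/-- The derivative of the implicit function associated with a derivative `M` of a parametrized
contraction. -/
noncomputable def implicitFixedPointDeriv (M : E × G →L[ℝ] G) : E →L[ℝ] G :=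
  Ring.inverse (1 - M ∘L ContinuousLinearMap.inr ℝ E G) ∘L (M ∘L ContinuousLinearMap.inl ℝ E G)

/-- The unit hypothesis excludes the default value `0` of `Ring.inverse`. -/
lemma implicitFixedPointDeriv_apply {M : E × G →L[ℝ] G}
    (hM : IsUnit (1 - M ∘L ContinuousLinearMap.inr ℝ E G)) (h : E) :
    implicitFixedPointDeriv M h = M (h, implicitFixedPointDeriv M h) := by
  have h2 : implicitFixedPointDeriv M h =
      Ring.inverse (1 - M ∘L ContinuousLinearMap.inr ℝ E G) (M (h, 0)) := by
    simp [implicitFixedPointDeriv]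
  have h1 : implicitFixedPointDeriv M h - M (0, implicitFixedPointDeriv M h) = M (h, 0) := by
    rw [h2]
    exact congrArg (fun A : G →L[ℝ] G => A (M (h, 0))) (Ring.mul_inverse_cancel _ hM)
  have h3 : ((h, implicitFixedPointDeriv M h) : E × G) =
      (h, 0) + (0, implicitFixedPointDeriv M h) := by
    simp
  rw [h3, map_add, ← h1, sub_add_cancel]

lemma eq_implicitFixedPointDeriv_apply {M : E × G →L[ℝ] G}
    (hM : IsUnit (1 - M ∘L ContinuousLinearMap.inr ℝ E G)) {h : E} {w : G} (hw : w = M (h, w)) :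
    w = implicitFixedPointDeriv M h := by
  have h1 : Ring.inverse (1 - M ∘L ContinuousLinearMap.inr ℝ E G) (w - M (0, w)) = w :=
    congrArg (fun A : G →L[ℝ] G => A w) (Ring.inverse_mul_cancel _ hM)
  have h2 : ((h, w) : E × G) = (h, 0) + (0, w) := by simp
  have h3 : w - M (0, w) = M (h, 0) := by
    rw [h2, map_add] at hw
    exact sub_eq_iff_eq_add.2 hw
  rw [h3] at h1
  simpa [implicitFixedPointDeriv] using h1.symm

lemma continuousAt_implicitFixedPointDeriv [CompleteSpace G] {M : E × G →L[ℝ] G}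
    (hM : IsUnit (1 - M ∘L ContinuousLinearMap.inr ℝ E G)) :
    ContinuousAt (implicitFixedPointDeriv (E := E) (G := G)) M := by
  have h1 : ContinuousAt (fun M : E × G →L[ℝ] G =>
      Ring.inverse (1 - M ∘L ContinuousLinearMap.inr ℝ E G)) M := by
    obtain ⟨u, hu⟩ := hM
    refine ContinuousAt.comp (g := Ring.inverse) (f := fun M : E × G →L[ℝ] G =>
      1 - M ∘L ContinuousLinearMap.inr ℝ E G) ?_ (by fun_prop)
    rw [← hu]
    exact NormedRing.inverse_continuousAt u
  exact h1.clm_comp (by fun_prop)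

/-- Apart from `‖M‖`, the bound depends only on `κ` and `L`, so local boundedness of the Clarke
Jacobian carries over. -/
lemma norm_implicitFixedPointDeriv_le (hκ : κ < 1) {M : E × G →L[ℝ] G}
    (hM : IsUnit (1 - M ∘L ContinuousLinearMap.inr ℝ E G))
    (hV : ∀ h, ‖L (M (0, h))‖ ≤ κ * ‖L h‖) :
    ‖implicitFixedPointDeriv M‖ ≤
      ‖(L.symm : H →L[ℝ] G)‖ * ((1 - κ)⁻¹ * (‖(L : G →L[ℝ] H)‖ * ‖M‖)) := by
  have hκ' : 0 ≤ (1 - κ)⁻¹ := inv_nonneg.2 (by linarith)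
  refine ContinuousLinearMap.opNorm_le_bound _ (by positivity) fun h => ?_
  set w := implicitFixedPointDeriv M h with hw
  have h1 : w = M (h, 0) + M (0, w) := by
    rw [← map_add]
    simpa using implicitFixedPointDeriv_apply hM h
  have h2 : ‖L w‖ ≤ ‖L (M (h, 0))‖ + κ * ‖L w‖ := by
    conv_lhs => rw [h1, map_add]
    exact (norm_add_le _ _).trans (by gcongr; exact hV w)
  have h3 : ‖L (M (h, 0))‖ ≤ ‖(L : G →L[ℝ] H)‖ * (‖M‖ * ‖h‖) := by
    refine ((L : G →L[ℝ] H).le_opNorm _).trans (mul_le_mul_of_nonneg_left ?_ (norm_nonneg _))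
    simpa [Prod.norm_def] using M.le_opNorm (h, 0)
  have h4 : ‖L w‖ ≤ (1 - κ)⁻¹ * (‖(L : G →L[ℝ] H)‖ * (‖M‖ * ‖h‖)) := by
    rw [inv_mul_eq_div, le_div_iff₀ (by linarith)]
    linarith
  have h5 : ‖w‖ ≤ ‖(L.symm : H →L[ℝ] G)‖ * ‖L w‖ := by
    simpa using (L.symm : H →L[ℝ] G).le_opNorm (L w)
  calc ‖w‖ ≤ _ := h5.trans (mul_le_mul_of_nonneg_left h4 (norm_nonneg _))
    _ = _ := by ring

variable [FiniteDimensional ℝ E] [FiniteDimensional ℝ G]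

/-- Nonsmooth implicit differentiation of the fixed point of a path differentiable parametrized
contraction. -/
theorem isConservativeJacobianOn_fixedPoint (hU : IsOpen U) (hκ : κ < 1)
    (hTκ : ∀ θ ∈ U, ∀ z z', ‖L (T (θ, z) - T (θ, z'))‖ ≤ κ * ‖L (z - z')‖)
    (hz : ∀ θ ∈ U, T (θ, zstar θ) = zstar θ) (hT : PathDifferentiableOn (U ×ˢ univ) T) :
    IsConservativeJacobianOn U zstar fun θ =>
      implicitFixedPointDeriv '' clarkeJacobian T (θ, zstar θ) := by
  have := FiniteDimensional.complete ℝ G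
  have : ProperSpace (E × G →L[ℝ] G) := FiniteDimensional.proper ℝ _
  have hUo : IsOpen (U ×ˢ (univ : Set G)) := hU.prod isOpen_univ
  have hlip := hT.1
  have hcont : ∀ θ ∈ U, ContinuousAt zstar θ :=
    fun θ hθ => continuousAt_fixedPoint hU hκ hTκ hz hlip hθ
  have hV : ∀ θ ∈ U, ∀ M ∈ clarkeJacobian T (θ, zstar θ), ∀ h, ‖L (M (0, h))‖ ≤ κ * ‖L h‖ :=
    fun θ hθ M hM h => norm_apply_inr_le_of_mem_clarkeJacobian hU hTκ hθ hM h
  have hunit : ∀ θ ∈ U, ∀ M ∈ clarkeJacobian T (θ, zstar θ),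
      IsUnit (1 - M ∘L ContinuousLinearMap.inr ℝ E G) :=
    fun θ hθ M hM => isUnit_one_sub_of_contraction hκ fun h => by simpa using hV θ hθ M hM h
  have hgraph : ∀ θ ∈ U, Tendsto (fun θ' => (θ', zstar θ')) (𝓝 θ) (𝓝 (θ, zstar θ)) :=
    fun θ hθ => tendsto_id.prodMk_nhds (hcont θ hθ)
  have hbdd : ∀ θ ∈ U, ∃ C : ℝ, ∀ᶠ θ' in 𝓝 θ, ∀ M ∈ clarkeJacobian T (θ', zstar θ'), ‖M‖ ≤ C := by
    intro θ hθ
    obtain ⟨C, hC⟩ := exists_eventually_norm_clarkeJacobian_le hUo hlip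
      (x := (θ, zstar θ)) ⟨hθ, mem_univ _⟩
    exact ⟨C, (hgraph θ hθ).eventually hC⟩
  refine ⟨fun θ hθ => (clarkeJacobian_nonempty hUo hlip ⟨hθ, mem_univ _⟩).image _,
    fun θ hθ => ?_, fun θ hθ u hu => ?_, fun c hc hcU => ?_⟩
  · obtain ⟨C, hC⟩ := hbdd θ hθ
    refine ⟨‖(L.symm : H →L[ℝ] G)‖ * ((1 - κ)⁻¹ * (‖(L : G →L[ℝ] H)‖ * C)), ?_⟩
    filter_upwards [nhdsWithin_le_nhds hC, self_mem_nhdsWithin] with θ' h1 h2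
    rintro _ ⟨M, hM, rfl⟩
    have hκ' : 0 ≤ (1 - κ)⁻¹ := inv_nonneg.2 (by linarith)
    refine (norm_implicitFixedPointDeriv_le hκ (hunit θ' h2 M hM) (hV θ' h2 M hM)).trans ?_
    gcongr
    exact h1 M hM
  · obtain ⟨q, hq1, hq2⟩ := mem_closure_iff_seq_limit.1 hu
    choose hqU M hM hqM using hq1
    have hq3 : Tendsto (fun k => (q k).1) atTop (𝓝 θ) := (continuous_fst.tendsto _).comp hq2
    have hq4 : Tendsto (fun k => (q k).2) atTop (𝓝 u) := (continuous_snd.tendsto _).comp hq2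
    obtain ⟨C, hC⟩ := hbdd θ hθ
    have hev : ∃ᶠ k in atTop, M k ∈ Metric.closedBall (0 : E × G →L[ℝ] G) C :=
      ((hq3.eventually hC).mono fun k hk => by simpa using hk _ (hM k)).frequently
    -- Boundedness gives a limit of Clarke elements along a subsequence; inversion is continuous at
    -- this limit, where `1 - V` is again a unit.
    obtain ⟨M₀, -, φ, hφ, hM₀⟩ :=
      tendsto_subseq_of_frequently_bounded Metric.isBounded_closedBall hev
    have hmem : M₀ ∈ clarkeJacobian T (θ, zstar θ) := by
      refine mem_clarkeJacobian_of_mem_closure hUo hlip ⟨hθ, mem_univ _⟩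
        (mem_closure_iff_seq_limit.2 ⟨fun k => (((q (φ k)).1, zstar (q (φ k)).1), M (φ k)),
          fun k => hM (φ k), ?_⟩)
      exact ((hgraph θ hθ).comp (hq3.comp hφ.tendsto_atTop)).prodMk_nhds hM₀
    have h1 := ((continuousAt_implicitFixedPointDeriv (hunit θ hθ M₀ hmem)).tendsto).comp hM₀
    refine ⟨M₀, hmem, tendsto_nhds_unique h1 ?_⟩
    have h2 := hq4.comp hφ.tendsto_atTop
    refine h2.congr fun k => ?_
    simp [← hqM]
  · obtain ⟨K, hK⟩ := LocallyLipschitzOn.exists_lipschitzOnWith_of_compact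
      (s := c '' uIcc 0 1) (isCompact_uIcc.image_of_continuousOn hc.continuousOn)
      ((locallyLipschitzOn_fixedPoint hU hκ hTκ hz hlip).mono (by
        rintro _ ⟨s, hs, rfl⟩
        rw [uIcc_of_le zero_le_one] at hs
        exact hcU s hs))
    have hzc := hc.comp_lipschitzOnWith hK
    -- The endpoints are discarded because the fixed-point identity along `c` holds only on `[0,
    -- 1]`, and differentiating it requires a full neighbourhood of `t`.
    have hne : ∀ a : ℝ, ∀ᵐ t ∂(volume.restrict (Icc (0 : ℝ) 1)), t ≠ a := fun a =>
      ae_restrict_of_ae (by simp [ae_iff, measure_singleton])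
    filter_upwards [(hT.isConservativeJacobianOn_clarkeJacobian hUo).chainRule
      (fun t => (c t, zstar (c t))) (hc.prodMk hzc) fun t ht => ⟨hcU t ht, mem_univ _⟩,
      hc.ae_differentiableAt_of_finiteDimensional, hzc.ae_differentiableAt_of_finiteDimensional,
      hne 0, hne 1, ae_restrict_mem measurableSet_Icc] with t ht hcd hzd ht0 ht1 hmem
    rintro _ ⟨M, hM, rfl⟩
    have hnear : (fun s => T (c s, zstar (c s))) =ᶠ[𝓝 t] fun s => zstar (c s) := by
      filter_upwards [Icc_mem_nhds (hmem.1.lt_of_ne ht0.symm) (hmem.2.lt_of_ne ht1)] with s hs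
      exact hz _ (hcU s hs)
    have h1 := (ht M hM).congr_of_eventuallyEq hnear.symm
    rw [(hcd.hasDerivAt.prodMk hzd.hasDerivAt).deriv] at h1
    have h2 := hzd.hasDerivAt.unique h1
    rw [← eq_implicitFixedPointDeriv_apply (hunit _ (hcU t hmem) M hM) h2]
    exact hzd.hasDerivAt

end FixedPoint

/-! ### Application to the resolvent of the min-max operator. -/

theorem theorem5p3 {p n m : ℕ} (Θ : Set (EuclideanSpace ℝ (Fin p)))
    (hΘo : IsOpen Θ) (hΘc : IsConnected Θ)
    (X : Set (EuclideanSpace ℝ (Fin n))) (hXne : X.Nonempty) (hXcl : IsClosed X)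
    (hXco : Convex ℝ X)
    (Y : Set (EuclideanSpace ℝ (Fin m))) (hYne : Y.Nonempty) (hYcp : IsCompact Y)
    (hYco : Convex ℝ Y)
    (Φ : EuclideanSpace ℝ (Fin p) → EuclideanSpace ℝ (Fin n) → EuclideanSpace ℝ (Fin m) → ℝ)
    (hΦcont : ∀ θ ∈ Θ, Continuous fun z : EuclideanSpace ℝ (Fin n) × EuclideanSpace ℝ (Fin m) =>
      Φ θ z.1 z.2)
    (hΦlip : ∀ x y, ∃ K, LipschitzOnWith K (fun θ => Φ θ x y) Θ)
    (α : ℝ) (hα : 0 < α)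
    (hconv : ∀ θ ∈ Θ, ∀ y, StrongConvexOn univ α (fun x => Φ θ x y))
    (hconc : ∀ θ ∈ Θ, ∀ x, StrongConcaveOn univ α (fun y => Φ θ x y))
    (γ : ℝ) (hγ : γ ∈ Ioo 0 (1 / α))
    (T : EuclideanSpace ℝ (Fin p) × (EuclideanSpace ℝ (Fin n) × EuclideanSpace ℝ (Fin m)) →
      EuclideanSpace ℝ (Fin n) × EuclideanSpace ℝ (Fin m))
    (hT : ∀ θ ∈ Θ, ∀ z, T (θ, z) = resolventMap γ (minMaxOperator X Y (Φ θ)) z)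
    (hTpath : PathDifferentiableOn (Θ ×ˢ univ) T) :
    (∀ θ ∈ Θ, ∃! z, IsSaddle X Y (Φ θ) z) ∧
    ∀ zstar : EuclideanSpace ℝ (Fin p) → EuclideanSpace ℝ (Fin n) × EuclideanSpace ℝ (Fin m),
      (∀ θ ∈ Θ, IsSaddle X Y (Φ θ) (zstar θ)) →
      PathDifferentiableOn Θ zstar ∧
      (∀ θ ∈ Θ, ∀ M ∈ clarkeJacobian T (θ, zstar θ),
        IsUnit (1 - M ∘L ContinuousLinearMap.inr ℝ _ _)) ∧
      IsConservativeJacobianOn Θ zstar fun θ =>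
        {L | ∃ M ∈ clarkeJacobian T (θ, zstar θ),
          L = Ring.inverse (1 - M ∘L ContinuousLinearMap.inr ℝ _ _) ∘L
            (M ∘L ContinuousLinearMap.inl ℝ _ _)} := by
  have hconv' : ∀ θ ∈ Θ, ∀ y, ConvexOn ℝ univ fun x => Φ θ x y :=
    fun θ hθ y => ((hconv θ hθ y).strictConvexOn hα).convexOn
  have hconc' : ∀ θ ∈ Θ, ∀ x, ConcaveOn ℝ univ fun y => Φ θ x y :=
    fun θ hθ x => ((hconc θ hθ x).strictConcaveOn hα).concaveOn
  have hγ0 : 0 < γ := hγ.1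
  have hres : ∀ θ ∈ Θ, ∀ z, ∃ w ∈ minMaxOperator X Y (Φ θ) (T (θ, z)), z = T (θ, z) + γ • w :=
    fun θ hθ z => resolventMap_minMaxOperator_spec hXne hXcl hXco hYne hYcp hYco (hΦcont θ hθ) hα
      (hconv θ hθ) (hconc' θ hθ) hγ0 (hT θ hθ z)
  refine ⟨fun θ hθ => ?_, fun zstar hz => ?_⟩
  · obtain ⟨z, hz⟩ := exists_isSaddle hXne hXcl hXco hYne hYcp hYco (hΦcont θ hθ) hα (hconv θ hθ)
      (hconc' θ hθ)
    exact ⟨z, hz, fun z' hz' =>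
      hz'.eq hXco hYco (hΦcont θ hθ) hα (hconv θ hθ) (hconc θ hθ) hz⟩
  have hκ : (1 + γ * α)⁻¹ < 1 := inv_lt_one_of_one_lt₀ (by linarith [mul_pos hγ0 hα])
  have hTκ : ∀ θ ∈ Θ, ∀ z z',
      ‖(WithLp.prodContinuousLinearEquiv 2 ℝ (EuclideanSpace ℝ (Fin n))
        (EuclideanSpace ℝ (Fin m))).symm (T (θ, z) - T (θ, z'))‖ ≤ (1 + γ * α)⁻¹ *
      ‖(WithLp.prodContinuousLinearEquiv 2 ℝ (EuclideanSpace ℝ (Fin n))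
        (EuclideanSpace ℝ (Fin m))).symm (z - z')‖ := by
    intro θ hθ z z'
    obtain ⟨a, ha, e⟩ := hres θ hθ z
    obtain ⟨a', ha', e'⟩ := hres θ hθ z'
    exact norm_prodEquiv_symm_sub_le_of_minMaxOperator hγ0 hα (hconv θ hθ) (hconc θ hθ) ha ha' e e'
  have hfix : ∀ θ ∈ Θ, T (θ, zstar θ) = zstar θ := by
    intro θ hθ
    obtain ⟨a, ha, e⟩ := hres θ hθ (zstar θ)
    have h0 := zero_mem_minMaxOperator_of_isSaddle hXco hYco (hΦcont θ hθ) (hconv' θ hθ)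
      (hconc' θ hθ) (hz θ hθ)
    -- Both `T(θ, zstar θ)` and `zstar θ` solve the resolvent equation with the same right-hand side
    -- `zstar θ`, the latter with operator value `0`, so the contraction bound identifies them.
    have h := norm_prodEquiv_symm_sub_le_of_minMaxOperator hγ0 hα (hconv θ hθ) (hconc θ hθ) ha h0 e
      (by simp : zstar θ = zstar θ + γ • 0)
    rw [sub_self, map_zero, norm_zero, mul_zero, norm_le_zero_iff,
      ContinuousLinearEquiv.map_eq_zero_iff, sub_eq_zero] at h
    exact h
  have hcons := isConservativeJacobianOn_fixedPoint hΘo hκ hTκ hfix hTpath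
  have hset : (fun θ => implicitFixedPointDeriv '' clarkeJacobian T (θ, zstar θ)) = fun θ =>
        {L | ∃ M ∈ clarkeJacobian T (θ, zstar θ),
          L = Ring.inverse (1 - M ∘L ContinuousLinearMap.inr ℝ _ _) ∘L
            (M ∘L ContinuousLinearMap.inl ℝ _ _)} := by
    funext θ
    ext A
    exact ⟨fun ⟨M, hM, h⟩ => ⟨M, hM, h.symm⟩, fun ⟨M, hM, h⟩ => ⟨M, hM, h.symm⟩⟩
  rw [hset] at hcons
  refine ⟨⟨locallyLipschitzOn_fixedPoint hΘo hκ hTκ hfix hTpath.1, _, hcons⟩,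
    fun θ hθ M hM => ?_, hcons⟩
  refine isUnit_one_sub_of_contraction (L := (WithLp.prodContinuousLinearEquiv 2 ℝ
    (EuclideanSpace ℝ (Fin n)) (EuclideanSpace ℝ (Fin m))).symm) hκ fun h => ?_
  exact norm_apply_inr_le_of_mem_clarkeJacobian hΘo hTκ (q := (θ, zstar θ)) hθ hM h
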